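/- Let $R\neq 0$ be a unital commutative associative ring in which $2$ is invertible. A bilinear form $B$ on an $R$-module $M$ is called nondegenerate if $x\mapsto B(x,\cdot)$ is an isomorphism $M\to\mathrm{Hom}_R(M,R)$; a cross product on a module $F$ is an alternating $R$-bilinear map $\times:F\times F\to F$. A composition algebra over $R$ is a unital, not necessarily associative $R$-algebra $C$ that is finitely generated projective and faithful as an $R$-module and carries a quadratic form $n:C\to R$ (its norm) whose polar form $n(x,y)=n(x+y)-n(x)-n(y)$ is nondegenerate and which satisfies $n(xy)=n(x)n(y)$ for all $x,y\in C$. Its conjugation is $\bar x=n(1,x)1-x$, and $\mathrm{Skew}(C)=\{x\in C:\bar x=-x\}$. For a symmetric bilinear form $B$ and a cross product $\times$ on $F$, the algebra $(R,F,B,\times)$ is the module $R\oplus F$ with the multiplication $(\alpha,u)(\beta,v)=(\alpha\beta-B(v,u),\ \alpha v+\beta u+v\times u)$. For a finitely generated projective module $F$ of constant rank $s$ put $\det F=\bigwedge^s F$. (i) Let $F$ be a finitely generated projective $R$-module of constant rank $s\ge 0$, let $B$ be a nondegenerate symmetric bilinear form on $F$ and $\times$ a cross product on $F$ such that (1) $B(u\times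 v,u\times v)=B(u,u)B(v,v)-B(u,v)^2$ and (2) $B(u,u\times v)=0$ for all $u,v\in F$. Then $(R,F,B,\times)$ is a composition algebra over $R$. Moreover $s\in\{0,1,3,7\}$, and $\det F\cong R$ if $s\neq 1$, while $\det F\otimes_R\det F\cong R$ in all cases, including $s=1$. (ii) Conversely, let $C$ be a composition algebra over $R$ with norm $n$, of constant rank $s+1\ge 1$, and let $F=\mathrm{Skew}(C)$. Then $r\mapsto r1$ is injective, $C=R1\oplus F$, and $F$ is finitely generated projective of constant rank $s$. Moreover $s\in\{0,1,3,7\}$, and $\det F\cong R$ if $s\neq 1$, while $\det F\otimes_R\det F\cong R$ in all cases. For $u,v\in F$ the element $u\times v=\frac12(uv-vu)$ lies in $F$, and there is a bilinear form $B:F\times F\to R$ with $B(u,v)1=-\frac12(uv+vu)=\frac12(u\bar v+v\bar u)$ and $B(u,v)=\frac12 n(u,v)$. The map $\times$ is a cross product on $F$, the form $B$ is symmetric and nondegenerate, and they satisfy (1) and (2) for all $u,v\in F$. -/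

import Mathlib

open scoped TensorProduct

universe u v w

namespace CrossProductAlgebra

/-- A bilinear form on `M` is nondegenerate if it induces an isomorphism from `M` onto its dual
module `Hom_R(M, R)`. -/
def IsNondegenerate {R : Type u} {M : Type v} [CommRing R] [AddCommGroup M] [Module R M]
    (B : LinearMap.BilinForm R M) : Prop :=
  Function.Bijective (fun x : M => (B x : Module.Dual R M))

/-- A finitely generated projective module has constant rank `s` if its rank at every prime ideal
of `R` is `s`. -/
def HasConstantRank (R : Type u) (M : Type v) [CommRing R] [AddCommGroup M] [Module R M]
    (s : ℕ) : Prop :=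
  ∀ p : PrimeSpectrum R, Module.rankAtStalk M p = s

/-- A cross product on a module is an alternating bilinear map from the module to itself. -/
def IsCrossProduct {R : Type u} {M : Type v} [CommRing R] [AddCommGroup M] [Module R M]
    (cr : M →ₗ[R] M →ₗ[R] M) : Prop :=
  ∀ x : M, cr x x = 0

section Composition

variable {R : Type u} {C : Type v} [CommRing R] [NonAssocRing C] [Module R C]

/-- The quadratic form `n` is nondegenerate and permits composition. -/
structure IsCompositionNorm (n : QuadraticForm R C) : Prop where
  nondegenerate : IsNondegenerate (QuadraticMap.polarBilin n)
  map_mul : ∀ x y : C, n (x * y) = n x * n y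

variable (R C) in
/-- A composition algebra: a unital nonassociative algebra, faithfully projective (that is,
finitely generated projective and faithful) as a module, which carries a nondegenerate quadratic
form permitting composition. -/
structure IsCompositionAlgebra [IsScalarTower R C C] [SMulCommClass R C C] : Prop where
  finite : Module.Finite R C
  projective : Module.Projective R C
  faithful : FaithfulSMul R C
  exists_norm : ∃ n : QuadraticForm R C, IsCompositionNorm n

/-- The conjugation `x ↦ n(1, x) 1 - x` attached to a quadratic form `n`. -/
def conj (n : QuadraticForm R C) : C →ₗ[R] C :=
  (QuadraticMap.polarBilin n 1).smulRight (1 : C) - LinearMap.id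

/-- The submodule of elements that are skew with respect to the conjugation. -/
def skew (n : QuadraticForm R C) : Submodule R C where
  carrier := {x | conj n x = -x}
  zero_mem' := by simp
  add_mem' := by
    intro a b ha hb
    simp only [Set.mem_ofPred_eq] at ha hb ⊢
    rw [map_add, ha, hb, neg_add]
  smul_mem' := by
    intro c a ha
    simp only [Set.mem_ofPred_eq] at ha ⊢
    rw [map_smul, ha, smul_neg]

end Composition

section Construction

variable {R : Type u} {F : Type v} [CommRing R] [AddCommGroup F] [Module R F]

/-- The underlying module `R ⊕ F` of the algebra `(R, F, B, ×)`. -/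
@[ext]
structure CrossAlgebra (B : LinearMap.BilinForm R F) (cr : F →ₗ[R] F →ₗ[R] F) :
    Type (max u v) where
  fst : R
  snd : F

variable (B : LinearMap.BilinForm R F) (cr : F →ₗ[R] F →ₗ[R] F)

/-- The identification of the elements of `(R, F, B, ×)` with pairs. -/
def CrossAlgebra.equivProd : CrossAlgebra B cr ≃ R × F where
  toFun x := (x.fst, x.snd)
  invFun p := ⟨p.1, p.2⟩
  left_inv _ := rfl
  right_inv _ := rfl

instance : AddCommGroup (CrossAlgebra B cr) := (CrossAlgebra.equivProd B cr).addCommGroup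

instance : Module R (CrossAlgebra B cr) := (CrossAlgebra.equivProd B cr).module R

/-- The algebra `(R, F, B, ×)` is `R ⊕ F` as a module. -/
def CrossAlgebra.linearEquivProd : CrossAlgebra B cr ≃ₗ[R] R × F :=
  (CrossAlgebra.equivProd B cr).linearEquiv R

instance : One (CrossAlgebra B cr) := ⟨⟨1, 0⟩⟩

/-- `(α, u) (β, v) = (α β - B(v, u), α v + β u + v × u)`. -/
instance : Mul (CrossAlgebra B cr) :=
  ⟨fun x y => ⟨x.fst * y.fst - B y.snd x.snd,
    x.fst • y.snd + y.fst • x.snd + cr y.snd x.snd⟩⟩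

variable {B cr}

theorem CrossAlgebra.zero_fst : (0 : CrossAlgebra B cr).fst = 0 := rfl
theorem CrossAlgebra.zero_snd : (0 : CrossAlgebra B cr).snd = 0 := rfl
theorem CrossAlgebra.one_fst : (1 : CrossAlgebra B cr).fst = 1 := rfl
theorem CrossAlgebra.one_snd : (1 : CrossAlgebra B cr).snd = 0 := rfl
theorem CrossAlgebra.add_fst (x y : CrossAlgebra B cr) : (x + y).fst = x.fst + y.fst := rfl
theorem CrossAlgebra.add_snd (x y : CrossAlgebra B cr) : (x + y).snd = x.snd + y.snd := rfl
theorem CrossAlgebra.smul_fst (r : R) (x : CrossAlgebra B cr) : (r • x).fst = r * x.fst := rfl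
theorem CrossAlgebra.smul_snd (r : R) (x : CrossAlgebra B cr) : (r • x).snd = r • x.snd := rfl
theorem CrossAlgebra.mul_fst (x y : CrossAlgebra B cr) :
    (x * y).fst = x.fst * y.fst - B y.snd x.snd := rfl
theorem CrossAlgebra.mul_snd (x y : CrossAlgebra B cr) :
    (x * y).snd = x.fst • y.snd + y.fst • x.snd + cr y.snd x.snd := rfl

open CrossAlgebra in
instance : NonAssocRing (CrossAlgebra B cr) :=
  { (inferInstance : AddCommGroup (CrossAlgebra B cr)),
    (inferInstance : Mul (CrossAlgebra B cr)),
    (inferInstance : One (CrossAlgebra B cr)) with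
    left_distrib := fun x y z => by
      apply CrossAlgebra.ext
      · simp only [mul_fst, add_fst, add_snd, map_add, LinearMap.add_apply]; ring
      · simp only [mul_snd, add_fst, add_snd, map_add, LinearMap.add_apply, smul_add, add_smul]
        abel
    right_distrib := fun x y z => by
      apply CrossAlgebra.ext
      · simp only [mul_fst, add_fst, add_snd, map_add]; ring
      · simp only [mul_snd, add_fst, add_snd, map_add, smul_add, add_smul]
        abel
    zero_mul := fun x => by
      apply CrossAlgebra.ext
      · simp [mul_fst, zero_fst, zero_snd]
      · simp [mul_snd, zero_fst, zero_snd]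
    mul_zero := fun x => by
      apply CrossAlgebra.ext
      · simp [mul_fst, zero_fst, zero_snd]
      · simp [mul_snd, zero_fst, zero_snd]
    one_mul := fun x => by
      apply CrossAlgebra.ext
      · simp [mul_fst, one_fst, one_snd]
      · simp [mul_snd, one_fst, one_snd]
    mul_one := fun x => by
      apply CrossAlgebra.ext
      · simp [mul_fst, one_fst, one_snd]
      · simp [mul_snd, one_fst, one_snd] }

open CrossAlgebra in
instance : IsScalarTower R (CrossAlgebra B cr) (CrossAlgebra B cr) :=
  ⟨fun r x y => by
    simp only [smul_eq_mul]
    apply CrossAlgebra.ext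
    · simp only [mul_fst, smul_fst, smul_snd, map_smul, smul_eq_mul]; ring
    · simp only [mul_snd, smul_fst, smul_snd, map_smul, smul_add, smul_smul, mul_comm]⟩

open CrossAlgebra in
instance : SMulCommClass R (CrossAlgebra B cr) (CrossAlgebra B cr) :=
  ⟨fun r x y => by
    simp only [smul_eq_mul]
    apply CrossAlgebra.ext
    · simp only [mul_fst, smul_fst, smul_snd, map_smul, LinearMap.smul_apply, smul_eq_mul]; ring
    · simp only [mul_snd, smul_fst, smul_snd, map_smul, LinearMap.smul_apply, smul_add, smul_smul,
        mul_comm]⟩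

end Construction

end CrossProductAlgebra

/-!
Both directions reduce to one structure: a finitely generated projective module `F` with a
nondegenerate symmetric form `B` and a compatible cross product (`IsVectorCrossProduct`).

*Translation.* On `R ⊕ F` the norm `(α, u) ↦ α² + B(u, u)` is multiplicative by a direct
computation. Conversely, linearizing `n(xy) = n(x) n(y)` gives `x x̄ = n(x) 1`, hence
`u v + v u = -n(u, v) 1` for skew `u, v`, and the axioms for `u × v = ½ (u v - v u)` follow from
`u × v = u v + B(u, v) 1`.

*Rank.* Fix a maximal ideal `m`. There are families in `F` itself which are exactly orthogonal and
whose squares `B(u, u)` lie outside `m` (`IsOrthoMod`). Such a family has at most `s` members, it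
can be extended by a vector while it is shorter than `s`, and one of length `s` generates `F` at
`m`. Two members `a, b` give a third, `a × b`. A fourth, `d`, orthogonal to these gives seven, the
new ones being `d × a`, `d × b`, `d × (a × b)`. An eighth, `e`, is impossible, because moving
factors around in `(a × b) × (d × e)` shows that this product equals its own negative, although its
square is outside `m`. So `s` is `0`, `1`, `3` or `7`.

*Determinant.* A linear form `φ` on `L = ⋀^s F` satisfies `φ(x) y = φ(y) x`, because `L` is locally
generated by one element. Hence `L ≅ R` as soon as some `φ` is nonzero modulo every maximal ideal,
and `L ⊗ L ≅ R` as soon as some bilinear form on `L` is; the form `det (B(uᵢ, vⱼ))` serves for the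
latter. For the former, `u ↦ (x ↦ x u)` extends to a representation of the Clifford algebra of `-B`
on `R ⊕ F`. Identify `⋀ F` with this Clifford algebra and let `φ` take the `R`-component of the
image of `1` (`IsVectorCrossProduct.volume`). On the families above with `s ∈ {0, 3, 7}` members it
is, up to sign, a product of squares `B(u, u)`. This construction has no denominators, so that
residue characteristics `3` and `7` need no special care.
-/

namespace CrossProductAlgebra

/-! ### Locally cyclic modules and exterior powers -/

section Determinant

variable {R : Type*} {F : Type*} [CommRing R] [AddCommGroup F] [Module R F]

theorem ιMulti_mem_span_singleton {s : ℕ} (u w : Fin s → F)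
    (hw : ∀ i, w i ∈ Submodule.span R (Set.range u)) :
    exteriorPower.ιMulti R s w ∈ Submodule.span R {exteriorPower.ιMulti R s u} := by
  choose c hc using fun i => (Submodule.mem_span_range_iff_exists_fun R).1 (hw i)
  obtain rfl : w = fun i => ∑ j, c i j • u j := funext fun i => (hc i).symm
  rw [← AlternatingMap.coe_multilinearMap, MultilinearMap.map_sum]
  refine Submodule.sum_mem _ fun σ _ => ?_
  rw [MultilinearMap.map_smul_univ]
  refine Submodule.smul_mem _ _ ?_
  change exteriorPower.ιMulti R s (u ∘ σ) ∈ _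
  by_cases hσ : Function.Injective σ
  · obtain ⟨τ, rfl⟩ : ∃ τ : Equiv.Perm (Fin s), ⇑τ = σ :=
      ⟨Equiv.ofBijective σ (Finite.injective_iff_bijective.1 hσ), rfl⟩
    rw [AlternatingMap.map_perm]
    rw [Units.smul_def]
    exact zsmul_mem (Submodule.mem_span_singleton_self _) _
  · simp only [Function.Injective, not_forall] at hσ
    obtain ⟨i, j, hij, hne⟩ := hσ
    rw [AlternatingMap.map_eq_zero_of_eq _ (u ∘ σ) (congrArg u hij) hne]
    exact zero_mem _

/-- If `s` elements generate `F` modulo `m`, then by Nakayama their exterior product generates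
`⋀^s F` up to a factor `r ∉ m`. Their linear independence is irrelevant. -/
theorem exists_smul_mem_span_ιMulti [Module.Finite R F] (m : Ideal R) [m.IsPrime] {s : ℕ}
    (u : Fin s → F)
    (hu : Submodule.span R (Set.range u) ⊔ m • (⊤ : Submodule R F) = ⊤) :
    ∃ r ∉ m, ∀ y : ⋀[R]^s F, r • y ∈ Submodule.span R {exteriorPower.ιMulti R s u} := by
  obtain ⟨r, hr, hle⟩ := Submodule.exists_sub_one_mem_and_smul_le_of_fg_of_le_sup
    (I := m) (N := Submodule.span R (Set.range u)) (N' := ⊤) (P := ⊤)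
    Module.Finite.fg_top le_top hu.ge
  have hrm : r ∉ m := fun h => (Ideal.ne_top_iff_one m).1 (Ideal.IsPrime.ne_top ‹_›) <| by
    simpa using sub_mem h hr
  refine ⟨r ^ s, fun h => hrm (Ideal.IsPrime.mem_of_pow_mem ‹_› _ h), fun y => ?_⟩
  have hy : y ∈ Submodule.span R (Set.range (exteriorPower.ιMulti R s (M := F))) := by
    rw [exteriorPower.ιMulti_span]; trivial
  induction hy using Submodule.span_induction with
  | mem x hx =>
    obtain ⟨w, rfl⟩ := hx
    have := (exteriorPower.ιMulti R s (M := F)).map_smul_univ (fun _ => r) w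
    simp only [Finset.prod_const, Finset.card_univ, Fintype.card_fin] at this
    rw [← this]
    exact ιMulti_mem_span_singleton u _ fun i =>
      hle (Submodule.smul_mem_pointwise_smul _ r _ trivial)
  | zero => simp
  | add x y _ _ hx hy => rw [smul_add]; exact add_mem hx hy
  | smul a x _ hx => rw [smul_comm]; exact Submodule.smul_mem _ _ hx

/-- On a locally cyclic module every linear form satisfies the identity `φ x • y = φ y • x`, since
the identity is plain for two multiples of one element. -/
theorem apply_smul_comm_of_locally_cyclic {L : Type*} [AddCommGroup L] [Module R L]
    (h : ∀ m : Ideal R, m.IsMaximal → ∃ r ∉ m, ∃ ω : L, ∀ y : L, r • y ∈ Submodule.span R {ω})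
    (φ : L →ₗ[R] R) (x y : L) : φ x • y = φ y • x := by
  rw [← sub_eq_zero]
  set z := φ x • y - φ y • x with hz
  suffices (Submodule.span R {z}).annihilator = ⊤ by
    have h1 : (1 : R) ∈ (Submodule.span R {z}).annihilator := this ▸ trivial
    simpa [Submodule.mem_annihilator_span_singleton] using h1
  by_contra hne
  obtain ⟨m, hm, hle⟩ := Ideal.exists_le_maximal _ hne
  obtain ⟨r, hr, ω, hω⟩ := h m hm
  obtain ⟨a, ha⟩ := Submodule.mem_span_singleton.1 (hω x)
  obtain ⟨b, hb⟩ := Submodule.mem_span_singleton.1 (hω y)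
  have hmem : r * r ∈ (Submodule.span R {z}).annihilator := by
    rw [Submodule.mem_annihilator_span_singleton]
    have e1 : (r * r) • z = φ (r • x) • (r • y) - φ (r • y) • (r • x) := by
      simp only [hz, map_smul, smul_eq_mul, smul_sub, smul_smul]
      congr 2 <;> ring
    rw [e1, ← ha, ← hb]
    simp only [map_smul, smul_eq_mul, smul_smul]
    rw [sub_eq_zero]
    congr 1
    ring
  exact (hm.isPrime.mem_or_mem (hle hmem)).elim hr hr

theorem surjective_of_forall_isMaximal {L : Type*} [AddCommGroup L] [Module R L] (φ : L →ₗ[R] R)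
    (h : ∀ m : Ideal R, m.IsMaximal → ∃ x, φ x ∉ m) : Function.Surjective φ := by
  rw [← LinearMap.range_eq_top]
  by_contra hne
  obtain ⟨m, hm, hle⟩ := Ideal.exists_le_maximal (LinearMap.range φ) hne
  obtain ⟨x, hx⟩ := h m hm
  exact hx (hle ⟨x, rfl⟩)

theorem nonempty_linearEquiv_of_surjective {L : Type*} [AddCommGroup L] [Module R L]
    (φ : L →ₗ[R] R) (hφ : Function.Surjective φ) (hcomm : ∀ x y, φ x • y = φ y • x) :
    Nonempty (L ≃ₗ[R] R) := by
  obtain ⟨a, ha⟩ := hφ 1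
  refine ⟨LinearEquiv.ofBijective φ ⟨?_, hφ⟩⟩
  rw [injective_iff_map_eq_zero]
  intro y hy
  simpa [ha, hy] using hcomm a y

/-- A bilinear form on a module with `φ x • y = φ y • x` which is nonzero modulo every maximal ideal
identifies the tensor square with `R`: the identity holds on the tensor square too, because in
`p(a, b) • x ⊗ y` the scalar can be exchanged in one factor at a time. -/
theorem nonempty_tensor_linearEquiv_of_forall_isMaximal {L : Type*} [AddCommGroup L] [Module R L]
    (p : L →ₗ[R] L →ₗ[R] R) (hp : ∀ m : Ideal R, m.IsMaximal → ∃ x y, p x y ∉ m)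
    (hcomm : ∀ (φ : L →ₗ[R] R) (x y : L), φ x • y = φ y • x) :
    Nonempty ((L ⊗[R] L) ≃ₗ[R] R) := by
  refine nonempty_linearEquiv_of_surjective (TensorProduct.lift p)
    (surjective_of_forall_isMaximal _ fun m hm => ?_) fun s t => ?_
  · obtain ⟨x, y, hxy⟩ := hp m hm
    exact ⟨x ⊗ₜ y, hxy⟩
  induction s using TensorProduct.induction_on with
  | zero => simp
  | add s₁ s₂ h₁ h₂ => rw [map_add, add_smul, h₁, h₂, smul_add]
  | tmul a b =>
    induction t using TensorProduct.induction_on with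
    | zero => simp
    | add t₁ t₂ h₁ h₂ => rw [map_add, add_smul, ← h₁, ← h₂, smul_add]
    | tmul x y =>
      -- `p(a, b) x ⊗ y = p(x, b) a ⊗ y = a ⊗ p(x, b) y = a ⊗ p(x, y) b`
      have h1 := hcomm (p.flip b) a x
      have h2 := hcomm (p x) b y
      simp only [LinearMap.flip_apply] at h1
      rw [TensorProduct.lift.tmul, TensorProduct.lift.tmul, TensorProduct.smul_tmul', h1,
        ← TensorProduct.smul_tmul', ← TensorProduct.tmul_smul, h2, TensorProduct.tmul_smul]

end Determinant

/-! ### Orthogonal families that are anisotropic modulo a maximal ideal -/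

section Orthogonal

variable {R : Type*} {F : Type*} [CommRing R] [AddCommGroup F] [Module R F]

/-- A finite family of pairwise orthogonal vectors whose squares `B(u, u)` lie outside the ideal `m`.
The orthogonality is exact, not merely modulo `m`. It is required for `i < j` only, which suffices
for a symmetric form. -/
def IsOrthoMod (B : LinearMap.BilinForm R F) (m : Ideal R) {k : ℕ} (u : Fin k → F) : Prop :=
  (∀ i j, i < j → B (u i) (u j) = 0) ∧ ∀ i, B (u i) (u i) ∉ m

variable {B : LinearMap.BilinForm R F} {m : Ideal R}

theorem isOrthoMod_zero (u : Fin 0 → F) : IsOrthoMod B m u :=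
  ⟨fun i => i.elim0, fun i => i.elim0⟩

theorem isOrthoMod_cons {k : ℕ} {w : F} {u : Fin k → F} :
    IsOrthoMod B m (Matrix.vecCons w u : Fin (k + 1) → F) ↔
      (∀ i, B w (u i) = 0) ∧ B w w ∉ m ∧ IsOrthoMod B m u := by
  simp only [IsOrthoMod, Fin.forall_fin_succ, Matrix.cons_val_zero, Matrix.cons_val_succ,
    Fin.succ_pos, Fin.not_lt_zero, Fin.succ_lt_succ_iff,
    false_imp_iff, true_and, forall_const]
  tauto

theorem IsOrthoMod.apply_eq_zero (hB : B.IsSymm) {k : ℕ} {u : Fin k → F} (hu : IsOrthoMod B m u)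
    {i j : Fin k} (hij : i ≠ j) : B (u i) (u j) = 0 := by
  rcases lt_or_gt_of_ne hij with h | h
  · exact hu.1 i j h
  · rw [← hB.eq]; exact hu.1 j i h

theorem finrank_quotient_eq [Module.Finite R F] [Module.Projective R F] {s : ℕ}
    (hs : HasConstantRank R F s) (m : Ideal R) [hm : m.IsMaximal] :
    Module.finrank (R ⧸ m) (F ⧸ (m • (⊤ : Submodule R F))) = s := by
  let _ := Ideal.Quotient.field m
  have h1 := Module.rankAtStalk_baseChange (R := R) (M := F) (S := R ⧸ m)
    (⊥ : PrimeSpectrum (R ⧸ m))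
  rw [hs, Module.rankAtStalk_eq_finrank_of_free] at h1
  rw [← h1]
  exact ((TensorProduct.quotTensorEquivQuotSMul F m).extendScalarsOfSurjective
    Ideal.Quotient.mk_surjective).symm.finrank_eq

/-- Nondegeneracy passes to the fibre `F / m F`: the coordinates of `x` in a dual basis are values of
the form. -/
theorem mem_smul_top_of_apply_mem [Module.Finite R F] [Module.Projective R F]
    (hB : B.IsSymm) (hnd : IsNondegenerate B) (m : Ideal R) {x : F} (hx : ∀ y, B x y ∈ m) :
    x ∈ m • (⊤ : Submodule R F) := by
  obtain ⟨n, f, g, -, -, hfg⟩ := Module.Finite.exists_comp_eq_id_of_projective R F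
  have hx' : x = ∑ i, g x i • f (Pi.single i 1) := by
    conv_lhs => rw [← LinearMap.id_apply (R := R) x, ← hfg, LinearMap.comp_apply,
      pi_eq_sum_univ' (g x)]
    simp only [map_sum, map_smul]
  rw [hx']
  refine Submodule.sum_mem _ fun i _ => Submodule.smul_mem_smul ?_ trivial
  obtain ⟨y, hy⟩ := hnd.2 (LinearMap.proj i ∘ₗ g)
  have : g x i = B y x := by
    change B y = _ at hy
    rw [hy]; rfl
  rw [this, ← hB.eq]
  exact hx y

theorem IsOrthoMod.le_rank [Module.Finite R F] [Module.Projective R F] {s : ℕ}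
    (hs : HasConstantRank R F s) (hB : B.IsSymm) [hm : m.IsMaximal] {k : ℕ} {u : Fin k → F}
    (hu : IsOrthoMod B m u) : k ≤ s := by
  let _ := Ideal.Quotient.field m
  have hli : LinearIndependent (R ⧸ m)
      (fun i => (Submodule.Quotient.mk (u i) : F ⧸ (m • (⊤ : Submodule R F)))) := by
    rw [Fintype.linearIndependent_iff]
    intro g hg j
    choose c hc using fun i => Ideal.Quotient.mk_surjective (g i)
    obtain rfl : g = fun i => Ideal.Quotient.mk m (c i) := funext fun i => (hc i).symm
    have hg' : (Submodule.Quotient.mk (∑ i, c i • u i) : F ⧸ (m • (⊤ : Submodule R F))) = 0 := by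
      rw [← hg, ← Submodule.mkQ_apply, map_sum]
      rfl
    rw [Submodule.Quotient.mk_eq_zero] at hg'
    have hmem : ∀ x ∈ m • (⊤ : Submodule R F), ∀ y, B x y ∈ m := by
      intro x hx y
      refine Submodule.smul_induction_on hx (fun r hr z _ => ?_) fun a b ha hb => ?_
      · simpa using m.mul_mem_right _ hr
      · simpa using add_mem ha hb
    have h2 := hmem _ hg' (u j)
    rw [map_sum, LinearMap.sum_apply, Finset.sum_eq_single j] at h2
    · rw [map_smul, LinearMap.smul_apply, smul_eq_mul] at h2
      exact Ideal.Quotient.eq_zero_iff_mem.2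
        ((hm.isPrime.mem_or_mem h2).resolve_right (hu.2 j))
    · intro i _ hij
      rw [map_smul, LinearMap.smul_apply, hu.apply_eq_zero hB hij, smul_zero]
    · simp
  have := hli.fintype_card_le_finrank
  rwa [Fintype.card_fin, finrank_quotient_eq hs] at this

theorem le_of_span_sup_eq_top [Module.Finite R F] [Module.Projective R F] {s : ℕ}
    (hs : HasConstantRank R F s) [hm : m.IsMaximal] {k : ℕ} {u : Fin k → F}
    (hu : Submodule.span R (Set.range u) ⊔ m • (⊤ : Submodule R F) = ⊤) : s ≤ k := by
  let _ := Ideal.Quotient.field m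
  rw [← finrank_quotient_eq hs m]
  have hspan : Submodule.span (R ⧸ m) (Set.range
      (fun i => (Submodule.Quotient.mk (u i) : F ⧸ (m • (⊤ : Submodule R F))))) = ⊤ := by
    rw [eq_top_iff]
    rintro z -
    obtain ⟨x, rfl⟩ := Submodule.Quotient.mk_surjective _ z
    obtain ⟨y, hy, t, ht, rfl⟩ := Submodule.mem_sup.1 (hu.ge (Submodule.mem_top (x := x)))
    obtain ⟨c, rfl⟩ := (Submodule.mem_span_range_iff_exists_fun R).1 hy
    rw [Submodule.Quotient.mk_add, (Submodule.Quotient.mk_eq_zero _).2 ht, add_zero]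
    refine (Submodule.mem_span_range_iff_exists_fun _).2 ⟨fun i => Ideal.Quotient.mk m (c i), ?_⟩
    rw [← Submodule.mkQ_apply, map_sum]
    rfl
  have := finrank_le_of_span_eq_top hspan
  simpa using this

/-- Gram–Schmidt without division: some multiple `r • x` with `r ∉ m` is the sum of an element of
the span of `u` and a vector orthogonal to `u`. -/
theorem IsOrthoMod.exists_sub_mem_orthogonal (hB : B.IsSymm) [hm : m.IsPrime] {k : ℕ}
    {u : Fin k → F} (hu : IsOrthoMod B m u) (x : F) :
    ∃ r ∉ m, ∃ y ∈ Submodule.span R (Set.range u), ∀ i, B (r • x - y) (u i) = 0 := by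
  refine ⟨∏ i, B (u i) (u i), fun h => ?_,
    ∑ i, ((∏ j ∈ Finset.univ.erase i, B (u j) (u j)) * B x (u i)) • u i,
    Submodule.sum_mem _ fun i _ => Submodule.smul_mem _ _ (Submodule.subset_span ⟨i, rfl⟩),
    fun i => ?_⟩
  · obtain ⟨i, -, hi⟩ := (Ideal.IsPrime.prod_mem_iff (p := m)).1 h
    exact hu.2 i hi
  · rw [map_sub, LinearMap.sub_apply, map_sum, LinearMap.sum_apply, Finset.sum_eq_single i]
    · simp only [map_smul, LinearMap.smul_apply, smul_eq_mul]
      rw [← Finset.mul_prod_erase Finset.univ (fun j => B (u j) (u j)) (Finset.mem_univ i)]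
      ring
    · intro j _ hji
      rw [map_smul, LinearMap.smul_apply, hu.apply_eq_zero hB hji, smul_zero]
    · simp

/-- An orthogonal family that does not yet generate `F` modulo `m` can be extended. Otherwise `B`
would vanish modulo `m` on the orthogonal complement of `u`, which would then lie in `m F`. -/
theorem IsOrthoMod.exists_orthogonal [Module.Finite R F] [Module.Projective R F]
    [Invertible (2 : R)] (hB : B.IsSymm) (hnd : IsNondegenerate B) [hm : m.IsMaximal] {k : ℕ}
    {u : Fin k → F} (hu : IsOrthoMod B m u)
    (hne : Submodule.span R (Set.range u) ⊔ m • (⊤ : Submodule R F) ≠ ⊤) :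
    ∃ w, (∀ i, B w (u i) = 0) ∧ B w w ∉ m := by
  by_contra! hcon
  have hperp : ∀ w, (∀ i, B w (u i) = 0) → w ∈ m • (⊤ : Submodule R F) := by
    intro w hw
    refine mem_smul_top_of_apply_mem hB hnd m fun x => ?_
    obtain ⟨r, hr, y, hy, hxy⟩ := hu.exists_sub_mem_orthogonal hB x
    have hwy : B w y = 0 := by
      obtain ⟨c, rfl⟩ := (Submodule.mem_span_range_iff_exists_fun R).1 hy
      simp [hw]
    have h1 := hcon (w + (r • x - y)) fun i => by
      rw [map_add, LinearMap.add_apply, hw, hxy, add_zero]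
    -- polarization: `B` takes values in `m` on all pairs from the orthogonal complement
    have h2 : B w (r • x - y) = ⅟2 * (B (w + (r • x - y)) (w + (r • x - y)) - B w w
        - B (r • x - y) (r • x - y)) := by
      have h3 : B (r • x - y) w = B w (r • x - y) := hB.eq _ _
      simp only [map_add, LinearMap.add_apply, h3]
      linear_combination (-(B w (r • x - y))) * invOf_mul_self (2 : R)
    have h4 : B w (r • x - y) ∈ m := by
      rw [h2]
      exact m.mul_mem_left _ (sub_mem (sub_mem h1 (hcon _ hw)) (hcon _ hxy))
    rw [map_sub, hwy, sub_zero, map_smul, smul_eq_mul] at h4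
    exact (hm.isPrime.mem_or_mem h4).resolve_left hr
  refine hne (eq_top_iff.2 fun x _ => ?_)
  obtain ⟨r, hr, y, hy, hxy⟩ := hu.exists_sub_mem_orthogonal hB x
  obtain ⟨r', t, ht, h1⟩ := hm.exists_inv hr
  have hx : x = r' • (y + (r • x - y)) + t • x := by
    rw [add_sub_cancel, smul_smul, ← add_smul, h1, one_smul]
  rw [hx]
  exact add_mem (Submodule.smul_mem _ _ (add_mem (Submodule.mem_sup_left hy)
    (Submodule.mem_sup_right (hperp _ hxy))))
    (Submodule.mem_sup_right (Submodule.smul_mem_smul ht trivial))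

theorem exists_isOrthoMod [Module.Finite R F] [Module.Projective R F] [Invertible (2 : R)] {s : ℕ}
    (hs : HasConstantRank R F s) (hB : B.IsSymm) (hnd : IsNondegenerate B) (m : Ideal R)
    [hm : m.IsMaximal] {k : ℕ} (hk : k ≤ s) : ∃ u : Fin k → F, IsOrthoMod B m u := by
  induction k with
  | zero => exact ⟨Fin.elim0, isOrthoMod_zero _⟩
  | succ k ih =>
    obtain ⟨u, hu⟩ := ih (by omega)
    obtain ⟨w, hw, hww⟩ := hu.exists_orthogonal hB hnd fun h =>
      absurd (le_of_span_sup_eq_top hs h) (by omega)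
    exact ⟨Matrix.vecCons w u, isOrthoMod_cons.2 ⟨hw, hww, hu⟩⟩

theorem IsOrthoMod.span_sup_eq_top [Module.Finite R F] [Module.Projective R F]
    [Invertible (2 : R)] {s : ℕ} (hs : HasConstantRank R F s) (hB : B.IsSymm)
    (hnd : IsNondegenerate B) [hm : m.IsMaximal] {u : Fin s → F} (hu : IsOrthoMod B m u) :
    Submodule.span R (Set.range u) ⊔ m • (⊤ : Submodule R F) = ⊤ := by
  by_contra hne
  obtain ⟨w, hw, hww⟩ := hu.exists_orthogonal hB hnd hne
  have := (isOrthoMod_cons.2 ⟨hw, hww, hu⟩).le_rank hs hB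
  omega

theorem apply_smul_comm_exteriorPower [Module.Finite R F] [Module.Projective R F]
    [Invertible (2 : R)] {s : ℕ} (hs : HasConstantRank R F s) (hB : B.IsSymm)
    (hnd : IsNondegenerate B) (φ : ⋀[R]^s F →ₗ[R] R) (x y : ⋀[R]^s F) : φ x • y = φ y • x := by
  refine apply_smul_comm_of_locally_cyclic (fun m hm => ?_) φ x y
  obtain ⟨u, hu⟩ := exists_isOrthoMod hs hB hnd m le_rfl
  obtain ⟨r, hr, h⟩ := exists_smul_mem_span_ιMulti m u (hu.span_sup_eq_top hs hB hnd)
  exact ⟨r, hr, _, h⟩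

/-- A nondegenerate symmetric form on `F` trivializes the square of `det F` by means of the Gram
determinant. -/
theorem nonempty_det_tensor_det_linearEquiv [Module.Finite R F] [Module.Projective R F]
    [Invertible (2 : R)] {s : ℕ} (hs : HasConstantRank R F s) (hB : B.IsSymm)
    (hnd : IsNondegenerate B) : Nonempty (((⋀[R]^s F) ⊗[R] (⋀[R]^s F)) ≃ₗ[R] R) := by
  refine nonempty_tensor_linearEquiv_of_forall_isMaximal
    (exteriorPower.pairingDual R F s ∘ₗ exteriorPower.map s B) (fun m hm => ?_)
    (apply_smul_comm_exteriorPower hs hB hnd)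
  obtain ⟨u, hu⟩ := exists_isOrthoMod hs hB hnd m le_rfl
  refine ⟨exteriorPower.ιMulti R s u, exteriorPower.ιMulti R s u, ?_⟩
  have hdiag : (Matrix.of fun i j => B (u j) (u i)) =
      Matrix.diagonal fun i => B (u i) (u i) := by
    ext i j
    by_cases hij : i = j
    · subst hij; simp
    · rw [Matrix.of_apply, Matrix.diagonal_apply_ne _ hij, hu.apply_eq_zero hB (Ne.symm hij)]
  rw [LinearMap.comp_apply, exteriorPower.map_apply_ιMulti,
    exteriorPower.pairingDual_ιMulti_ιMulti]
  simp only [Function.comp_apply]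
  rw [hdiag, Matrix.det_diagonal]
  intro h
  obtain ⟨i, -, hi⟩ := (Ideal.IsPrime.prod_mem_iff (p := m)).1 h
  exact hu.2 i hi

end Orthogonal

/-! ### Cross products compatible with a bilinear form -/

section VectorCrossProduct

variable {R : Type*} {F : Type*} [CommRing R] [AddCommGroup F] [Module R F]

/-- A nondegenerate symmetric form `B` and a cross product such that `u × v` is orthogonal to `u`
and its square is the Gram determinant of `u` and `v`. -/
structure IsVectorCrossProduct (B : LinearMap.BilinForm R F) (cr : F →ₗ[R] F →ₗ[R] F) :
    Prop where
  isSymm : B.IsSymm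
  nondegenerate : IsNondegenerate B
  isCrossProduct : IsCrossProduct cr
  apply_cross_cross : ∀ u v : F, B (cr u v) (cr u v) = B u u * B v v - B u v ^ 2
  apply_cross_left : ∀ u v : F, B u (cr u v) = 0

namespace IsVectorCrossProduct

variable {B : LinearMap.BilinForm R F} {cr : F →ₗ[R] F →ₗ[R] F}

theorem comm (h : IsVectorCrossProduct B cr) (u v : F) : B u v = B v u :=
  h.isSymm.eq u v

theorem cross_anticomm (h : IsVectorCrossProduct B cr) (u v : F) : cr u v = -cr v u := by
  have h1 := h.isCrossProduct (u + v)
  simp only [map_add, LinearMap.add_apply, h.isCrossProduct u, h.isCrossProduct v, zero_add,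
    add_zero] at h1
  exact eq_neg_of_add_eq_zero_right h1

theorem triple_swap (h : IsVectorCrossProduct B cr) (u v w : F) :
    B u (cr v w) = -B v (cr u w) := by
  have h1 := h.apply_cross_left (u + v) w
  simp only [map_add, LinearMap.add_apply, h.apply_cross_left, zero_add, add_zero] at h1
  exact eq_neg_of_add_eq_zero_right h1

theorem triple_cycle (h : IsVectorCrossProduct B cr) (u v w : F) :
    B u (cr v w) = B w (cr u v) := by
  rw [h.cross_anticomm v w, map_neg, h.triple_swap u w v, neg_neg]

theorem apply_cross_right (h : IsVectorCrossProduct B cr) (u v : F) : B v (cr u v) = 0 := by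
  rw [h.triple_cycle, h.triple_cycle, h.isCrossProduct, map_zero]

theorem apply_cross_cross_polar [Invertible (2 : R)] (h : IsVectorCrossProduct B cr)
    (u v w : F) : B (cr u v) (cr u w) = B u u * B v w - B u v * B u w := by
  have h1 := h.apply_cross_cross u (v + w)
  simp only [map_add, LinearMap.add_apply, h.apply_cross_cross, h.comm w v,
    h.comm (cr u w) (cr u v)] at h1
  refine (isUnit_of_invertible (2 : R)).mul_left_cancel ?_
  linear_combination h1

/-- Compare the inner products of both sides with an arbitrary vector. -/
theorem cross_cross_self [Invertible (2 : R)] (h : IsVectorCrossProduct B cr) (u v : F) :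
    cr u (cr u v) = B u v • u - B u u • v := by
  refine h.nondegenerate.1 (LinearMap.ext fun w => ?_)
  have h1 := h.apply_cross_cross_polar u v w
  simp only [map_sub, map_smul, LinearMap.sub_apply, LinearMap.smul_apply, smul_eq_mul]
  rw [h.comm _ w, h.triple_cycle, h.cross_anticomm w u, map_neg, h1]
  ring

/-- On pairwise orthogonal vectors `u × (v × w)` changes sign when `u` and `v` are exchanged; with
`cross_anticomm` it is alternating there. -/
theorem cross_cross_anticomm [Invertible (2 : R)] (h : IsVectorCrossProduct B cr) {u v w : F}
    (huv : B u v = 0) (huw : B u w = 0) (hvw : B v w = 0) :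
    cr u (cr v w) = -cr v (cr u w) := by
  have h1 := h.cross_cross_self (u + v) w
  simp only [map_add, LinearMap.add_apply, h.cross_cross_self, h.comm v u, huv, huw, hvw,
    zero_smul, add_zero, zero_add, zero_sub, add_smul, smul_add] at h1
  rw [eq_neg_iff_add_eq_zero]
  have h2 : cr u (cr v w) + cr v (cr u w) = cr u (cr u w) + cr v (cr u w) +
      (cr u (cr v w) + cr v (cr v w)) - cr u (cr u w) - cr v (cr v w) := by abel
  rw [h2, h.cross_cross_self, h.cross_cross_self]
  simp only [huw, hvw, zero_smul, zero_sub]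
  rw [h1]
  abel

/-- There is no room for an eighth direction: if `d` is orthogonal to `a`, `b`, `a × b`, and `e` is
orthogonal to these, to `d`, `d × a` and `d × b`, then `(a × b) × (d × e)` equals both
`e × ((a × b) × d)` and its negative. -/
theorem cross_cross_cross_eq_zero [Invertible (2 : R)] (h : IsVectorCrossProduct B cr)
    {a b d e : F} (hab : B a b = 0) (hda : B d a = 0) (hdb : B d b = 0)
    (hdc : B d (cr a b) = 0) (hea : B e a = 0) (heb : B e b = 0) (hec : B e (cr a b) = 0)
    (hed : B e d = 0) (hep : B e (cr d a) = 0) (heq : B e (cr d b) = 0) :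
    cr (cr a b) (cr d e) = 0 := by
  have had := (h.comm a d).trans hda
  have hbd := (h.comm b d).trans hdb
  have hae := (h.comm a e).trans hea
  have hbe := (h.comm b e).trans heb
  have hde := (h.comm d e).trans hed
  have hce := (h.comm _ e).trans hec
  have hcd := (h.comm _ d).trans hdc
  have hax : B a (cr d e) = 0 := by rw [h.triple_cycle, h.cross_anticomm, map_neg, hep, neg_zero]
  have hbx : B b (cr d e) = 0 := by rw [h.triple_cycle, h.cross_anticomm, map_neg, heq, neg_zero]
  have hq : B a (cr b d) = 0 := by rw [h.triple_cycle, hdc]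
  have hqe : B e (cr b d) = 0 := by rw [h.cross_anticomm, map_neg, heq, neg_zero]
  -- alternation in the orthogonal triple `a × b`, `d`, `e`
  have e1 : cr (cr a b) (cr d e) = cr e (cr (cr a b) d) := by
    rw [h.cross_anticomm d e, map_neg, h.cross_cross_anticomm hce hcd hed, neg_neg]
  -- alternation first in `d × e`, `a`, `b`, then in `b`, `d`, `e`, then in `a`, `e`, `b × d`, and
  -- last in `a`, `b`, `d`
  have e2 : cr (cr a b) (cr d e) = -cr e (cr (cr a b) d) := by
    have hx : cr b (cr d e) = cr e (cr b d) := by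
      rw [h.cross_anticomm d e, map_neg, h.cross_cross_anticomm hbe hbd hed, neg_neg]
    have hy : cr a (cr b d) = cr d (cr a b) := by
      rw [h.cross_anticomm b d, map_neg, h.cross_cross_anticomm had hab hdb, neg_neg]
    rw [h.cross_anticomm, h.cross_cross_anticomm ((h.comm _ a).trans hax)
      ((h.comm _ b).trans hbx) hab, h.cross_anticomm (cr d e) b, map_neg, neg_neg, hx,
      h.cross_cross_anticomm hae hq hqe, neg_neg, hy, h.cross_anticomm d, map_neg]
  have h2 : (2 : R) • cr (cr a b) (cr d e) = 0 := by
    rw [two_smul]; nth_rw 1 [e1]; rw [e2, add_neg_cancel]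
  exact ((isUnit_of_invertible (2 : R)).smul_eq_zero).1 h2

theorem isOrthoMod_quaternion [Invertible (2 : R)] (h : IsVectorCrossProduct B cr) {m : Ideal R}
    [hm : m.IsPrime] {a b : F} (hab : B a b = 0) (ha : B a a ∉ m) (hb : B b b ∉ m) :
    IsOrthoMod B m ![cr a b, b, a] := by
  have hba := (h.comm b a).trans hab
  have hc : B (cr a b) (cr a b) ∉ m := by
    rw [h.apply_cross_cross, hab]
    simpa using hm.mul_notMem ha hb
  simp only [isOrthoMod_cons, Fin.forall_fin_succ]
  simp [ha, hb, hc, hba, h.comm (cr a b), h.apply_cross_left, h.apply_cross_right,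
    isOrthoMod_zero]

theorem isOrthoMod_octonion [Invertible (2 : R)] (h : IsVectorCrossProduct B cr) {m : Ideal R}
    [hm : m.IsPrime] {a b d : F} (hab : B a b = 0) (ha : B a a ∉ m) (hb : B b b ∉ m)
    (hda : B d a = 0) (hdb : B d b = 0) (hdc : B d (cr a b) = 0) (hd : B d d ∉ m) :
    IsOrthoMod B m ![cr a b, b, a, d, cr d a, cr d b, cr d (cr a b)] := by
  have hba := (h.comm b a).trans hab
  have had := (h.comm a d).trans hda
  have hbd := (h.comm b d).trans hdb
  have hcd := (h.comm _ d).trans hdc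
  have hc : B (cr a b) (cr a b) ∉ m := by
    rw [h.apply_cross_cross, hab]
    simpa using hm.mul_notMem ha hb
  have hp : B (cr d a) (cr d a) ∉ m := by
    rw [h.apply_cross_cross, hda]
    simpa using hm.mul_notMem hd ha
  have hq : B (cr d b) (cr d b) ∉ m := by
    rw [h.apply_cross_cross, hdb]
    simpa using hm.mul_notMem hd hb
  have hr : B (cr d (cr a b)) (cr d (cr a b)) ∉ m := by
    rw [h.apply_cross_cross, hdc]
    simpa using hm.mul_notMem hd hc
  have hca : B (cr a b) a = 0 := by rw [h.comm, h.apply_cross_left]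
  have hcb : B (cr a b) b = 0 := by rw [h.comm, h.apply_cross_right]
  have hac : B a (cr a b) = 0 := h.apply_cross_left a b
  have hbc : B b (cr a b) = 0 := h.apply_cross_right a b
  have hcp : B (cr a b) (cr d a) = 0 := by
    rw [h.triple_swap, h.cross_anticomm, map_neg, h.cross_cross_self, hab]
    simp [hdb]
  have hcq : B (cr a b) (cr d b) = 0 := by
    rw [h.triple_swap, h.cross_anticomm a b, map_neg, LinearMap.neg_apply,
      h.cross_anticomm (cr b a), h.cross_cross_self, hba]
    simp [hda]
  have hbp : B b (cr d a) = 0 := by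
    rw [h.triple_cycle, h.triple_cycle, hdc]
  have haq : B a (cr d b) = 0 := by rw [h.triple_swap, hdc, neg_zero]
  have har : B a (cr d (cr a b)) = 0 := by
    rw [h.triple_swap, h.cross_cross_self, hab]
    simp [hdb]
  have hbr : B b (cr d (cr a b)) = 0 := by
    rw [h.triple_swap, h.cross_anticomm a b, map_neg, h.cross_cross_self, hba]
    simp [hda]
  have hpq : B (cr d a) (cr d b) = 0 := by
    rw [h.apply_cross_cross_polar, hab, hda]; simp
  have hpr : B (cr d a) (cr d (cr a b)) = 0 := by
    rw [h.apply_cross_cross_polar, hac, hda]; simp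
  have hqr : B (cr d b) (cr d (cr a b)) = 0 := by
    rw [h.apply_cross_cross_polar, hbc, hdb]; simp
  simp only [isOrthoMod_cons, Fin.forall_fin_succ]
  simp [ha, hb, hc, hd, hp, hq, hr, hba, had, hbd, hcd, hca, hcb, hcp, hcq, hbp, haq, har, hbr,
    hpq, hpr, hqr, h.apply_cross_left, h.apply_cross_right, isOrthoMod_zero]

end IsVectorCrossProduct

/-! ### The Clifford representation and the volume form -/

/-- Multiplication by `u` on `R ⊕ F`, as `(β, v) ↦ (-B(u, v), β u + u × v)`. This is right
multiplication by `(0, u)` in the algebra `(R, F, B, ×)`, whose product involves `v × u`. -/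
def cliffordMap (B : LinearMap.BilinForm R F) (cr : F →ₗ[R] F →ₗ[R] F) :
    F →ₗ[R] Module.End R (R × F) :=
  LinearMap.mk₂ R (fun u x => (-B u x.2, x.1 • u + cr u x.2))
    (fun u v x => by
      ext <;> simp only [map_add, LinearMap.add_apply, Prod.fst_add, Prod.snd_add, smul_add]
      · ring
      · abel)
    (fun r u x => by
      ext <;> simp only [map_smul, LinearMap.smul_apply, Prod.smul_fst, Prod.smul_snd, smul_add,
        smul_eq_mul, mul_neg, smul_comm r])
    (fun u x y => by
      ext <;> simp only [map_add, Prod.fst_add, Prod.snd_add, add_smul]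
      · ring
      · abel)
    (fun r u x => by
      ext <;> simp only [map_smul, Prod.smul_fst, Prod.smul_snd, smul_add,
        smul_eq_mul, mul_neg, mul_smul])

theorem cliffordMap_apply (B : LinearMap.BilinForm R F) (cr : F →ₗ[R] F →ₗ[R] F) (u : F)
    (x : R × F) : cliffordMap B cr u x = (-B u x.2, x.1 • u + cr u x.2) := rfl

theorem IsVectorCrossProduct.cliffordMap_mul_self [Invertible (2 : R)]
    {B : LinearMap.BilinForm R F} {cr : F →ₗ[R] F →ₗ[R] F} (h : IsVectorCrossProduct B cr)
    (u : F) : cliffordMap B cr u * cliffordMap B cr u =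
      algebraMap R _ ((LinearMap.BilinMap.toQuadraticMap (-B)) u) := by
  refine LinearMap.ext fun x => ?_
  rw [Module.End.mul_apply, Module.algebraMap_end_apply]
  ext
  · simp [cliffordMap_apply, h.apply_cross_left, mul_comm]
  · simp [cliffordMap_apply, h.cross_cross_self, h.isCrossProduct u]
    abel

/-- The comparison map between two Clifford algebras preserves products of vectors that are
orthogonal with respect to the difference of the forms. -/
theorem changeForm_prod_of_pairwise {Q Q' : QuadraticForm R F} {B : LinearMap.BilinForm R F}
    (hB : B.toQuadraticMap = Q' - Q) (l : List F) (hl : l.Pairwise fun x y => B x y = 0) :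
    CliffordAlgebra.changeForm hB (l.map (CliffordAlgebra.ι Q)).prod =
      (l.map (CliffordAlgebra.ι Q')).prod := by
  have hcontract : ∀ (d : Module.Dual R F) (l : List F), (∀ x ∈ l, d x = 0) →
      CliffordAlgebra.contractLeft d (l.map (CliffordAlgebra.ι Q')).prod = 0 := by
    intro d l hd
    induction l with
    | nil => simp
    | cons a l ih =>
      rw [List.forall_mem_cons] at hd
      rw [List.map_cons, List.prod_cons, CliffordAlgebra.contractLeft_ι_mul, hd.1, ih hd.2,
        zero_smul, mul_zero, sub_zero]
  induction l with
  | nil => simp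
  | cons a l ih =>
    rw [List.pairwise_cons] at hl
    rw [List.map_cons, List.prod_cons, CliffordAlgebra.changeForm_ι_mul, ih hl.2,
      hcontract _ _ hl.1, sub_zero, List.map_cons, List.prod_cons]

/-- The volume form on `⋀^s F`: identify `⋀ F = Cl(0)` with the Clifford algebra of `-B`, let it act
on `R ⊕ F` by `cliffordMap`, and take the `R`-component of the image of `1`. -/
noncomputable def IsVectorCrossProduct.volume [Invertible (2 : R)] {B : LinearMap.BilinForm R F}
    {cr : F →ₗ[R] F →ₗ[R] F} (h : IsVectorCrossProduct B cr) (s : ℕ) : ⋀[R]^s F →ₗ[R] R :=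
  LinearMap.fst R R F ∘ₗ LinearMap.applyₗ ((1, 0) : R × F) ∘ₗ
    (CliffordAlgebra.lift (LinearMap.BilinMap.toQuadraticMap (-B))
      ⟨cliffordMap B cr, h.cliffordMap_mul_self⟩).toLinearMap ∘ₗ
    CliffordAlgebra.changeForm (Q := 0) (B := -B) (sub_zero _).symm ∘ₗ (⋀[R]^s F).subtype

theorem IsVectorCrossProduct.volume_ιMulti [Invertible (2 : R)] {B : LinearMap.BilinForm R F}
    {cr : F →ₗ[R] F →ₗ[R] F} (h : IsVectorCrossProduct B cr) {m : Ideal R} {s : ℕ}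
    {u : Fin s → F} (hu : IsOrthoMod B m u) :
    h.volume s (exteriorPower.ιMulti R s u) =
      ((List.ofFn fun i => cliffordMap B cr (u i)).prod (1, 0)).1 := by
  have h1 : (exteriorPower.ιMulti R s u : ExteriorAlgebra R F) =
      ((List.ofFn u).map (CliffordAlgebra.ι 0)).prod := by
    rw [exteriorPower.ιMulti_apply_coe, ExteriorAlgebra.ιMulti_apply, List.map_ofFn]
    rfl
  have h2 : (List.ofFn u).Pairwise fun x y => (-B) x y = 0 := by
    rw [List.pairwise_ofFn]
    intro i j hij
    simp [hu.1 i j hij]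
  have h3 : CliffordAlgebra.changeForm (Q := 0) (B := -B) (sub_zero _).symm
      (exteriorPower.ιMulti R s u : ExteriorAlgebra R F) =
        ((List.ofFn u).map (CliffordAlgebra.ι (LinearMap.BilinMap.toQuadraticMap (-B)))).prod := by
    rw [h1]
    exact changeForm_prod_of_pairwise _ _ h2
  rw [volume, LinearMap.comp_apply, LinearMap.comp_apply, LinearMap.comp_apply,
    LinearMap.comp_apply, Submodule.subtype_apply, h3,
    AlgHom.toLinearMap_apply, map_list_prod]
  simp only [List.map_ofFn, Function.comp_def, CliffordAlgebra.lift_ι_apply]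
  rfl

/-- The possible ranks, together with the nonvanishing of the volume form modulo `m` outside rank
`1`; both come from the same construction of orthogonal families. -/
theorem IsVectorCrossProduct.rank_eq_and_exists_volume_notMem [Invertible (2 : R)]
    [Module.Finite R F] [Module.Projective R F] {B : LinearMap.BilinForm R F}
    {cr : F →ₗ[R] F →ₗ[R] F} (h : IsVectorCrossProduct B cr) {s : ℕ}
    (hs : HasConstantRank R F s) (m : Ideal R) [hm : m.IsMaximal] :
    (s = 0 ∨ s = 1 ∨ s = 3 ∨ s = 7) ∧ (s ≠ 1 → ∃ x, h.volume s x ∉ m) := by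
  have hextend : ∀ {k : ℕ} {u : Fin k → F}, IsOrthoMod B m u → k < s →
      ∃ w, (∀ i, B w (u i) = 0) ∧ B w w ∉ m := fun hu hk =>
    hu.exists_orthogonal h.isSymm h.nondegenerate fun htop =>
      absurd (le_of_span_sup_eq_top hs htop) (by omega)
  have hp := hm.isPrime
  rcases Nat.eq_zero_or_pos s with rfl | h0
  · refine ⟨Or.inl rfl, fun _ => ⟨exteriorPower.ιMulti R 0 Fin.elim0, ?_⟩⟩
    rw [h.volume_ιMulti (isOrthoMod_zero (m := m) _)]
    simpa using (Ideal.ne_top_iff_one m).1 hm.ne_top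
  rcases Nat.lt_or_ge 1 s with h1 | h1
  swap
  · have : s = 1 := by omega
    exact ⟨Or.inr (Or.inl this), fun hne => absurd this hne⟩
  obtain ⟨u, hu⟩ := exists_isOrthoMod hs h.isSymm h.nondegenerate m (show 2 ≤ s from h1)
  obtain ⟨a, b, ha, hb, hab⟩ : ∃ a b, B a a ∉ m ∧ B b b ∉ m ∧ B a b = 0 :=
    ⟨u 0, u 1, hu.2 0, hu.2 1, hu.1 0 1 (by decide)⟩
  have hba := (h.comm b a).trans hab
  have hcc : B (cr a b) (cr a b) = B a a * B b b := by
    rw [h.apply_cross_cross, hab]; ring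
  have hquat := h.isOrthoMod_quaternion hab ha hb
  rcases (hquat.le_rank hs h.isSymm).eq_or_lt with h3 | h3
  · obtain rfl : s = 3 := h3.symm
    refine ⟨by simp, fun _ => ⟨exteriorPower.ιMulti R 3 ![cr a b, b, a], ?_⟩⟩
    rw [h.volume_ιMulti hquat]
    simp [cliffordMap_apply, hba, h.cross_anticomm b a, hcc]
    exact hp.mul_notMem ha hb
  obtain ⟨d, hd, hdd⟩ := hextend hquat h3
  have hdc : B d (cr a b) = 0 := hd 0
  have hdb : B d b = 0 := hd 1
  have hda : B d a = 0 := hd 2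
  have hoct := h.isOrthoMod_octonion hab ha hb hda hdb hdc hdd
  rcases (hoct.le_rank hs h.isSymm).eq_or_lt with h7 | h7
  · obtain rfl : s = 7 := h7.symm
    refine ⟨by simp, fun _ => ⟨exteriorPower.ιMulti R 7
      ![cr a b, b, a, d, cr d a, cr d b, cr d (cr a b)], ?_⟩⟩
    -- `d`, `d × a`, `d × b`, `d × (a × b)` act on `1` by a scalar, and so do `a × b`, `b`, `a`
    have hcb : cr (cr a b) b = -(B b b • a) := by
      rw [h.cross_anticomm, h.cross_anticomm a b, map_neg, h.cross_cross_self, hba]; simp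
    have hbd := (h.comm b d).trans hdb
    have hcd := (h.comm _ d).trans hdc
    have hcb' : B (cr a b) b = 0 := by rw [h.comm, h.apply_cross_right]
    have hqd : B (cr d b) d = 0 := by rw [h.comm, h.apply_cross_left]
    have hqc : B (cr d b) (cr a b) = 0 := (h.comm _ _).trans (hoct.1 0 5 (by decide))
    have hqcr : cr (cr d b) (cr a b) = -(B b b • cr d a) := by
      rw [h.cross_anticomm, h.cross_cross_anticomm hcd hcb' hdb, neg_neg, hcb, map_neg, map_smul]
    have hqr : cr (cr d b) (cr d (cr a b)) = -((B b b * B d d) • a) := by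
      rw [h.cross_cross_anticomm hqd hqc hdc, hqcr, map_neg, neg_neg, map_smul,
        h.cross_cross_self, hda]
      simp [mul_smul]
    have hpa : cr (cr d a) a = -(B a a • d) := by
      rw [h.cross_anticomm, h.cross_anticomm d a, map_neg, neg_neg, h.cross_cross_self,
        h.comm a d, hda]
      simp
    have hpa' : B (cr d a) a = 0 := by rw [h.comm, h.apply_cross_right]
    have hqr' : B (cr d b) (cr d (cr a b)) = 0 := hoct.1 5 6 (by decide)
    rw [h.volume_ιMulti hoct]
    simp [cliffordMap_apply, hba, h.cross_anticomm b a, hcc, hqr', hqr, hpa, hpa',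
      h.isCrossProduct d]
    exact hp.mul_notMem (hp.mul_notMem (hp.mul_notMem hb hdd) (hp.mul_notMem ha hdd))
      (hp.mul_notMem ha hb)
  obtain ⟨e, he, hee⟩ := hextend hoct h7
  have hz := h.cross_cross_cross_eq_zero hab hda hdb hdc (he 2) (he 1) (he 0) (he 3) (he 4) (he 5)
  have hn := h.apply_cross_cross (cr a b) (cr d e)
  have hcx : B (cr a b) (cr d e) = 0 := by
    rw [h.triple_cycle, h.cross_anticomm, map_neg, show B e (cr d (cr a b)) = 0 from he 6,
      neg_zero]
  rw [hz, map_zero, hcc, hcx, h.apply_cross_cross, h.comm d e, show B e d = 0 from he 3] at hn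
  have hmem : B a a * B b b * (B d d * B e e) ∈ m := by
    have : B a a * B b b * (B d d * B e e) = 0 := by linear_combination -hn
    rw [this]; exact m.zero_mem
  exact absurd hmem (hp.mul_notMem (hp.mul_notMem ha hb) (hp.mul_notMem hdd hee))

variable {B : LinearMap.BilinForm R F} {cr : F →ₗ[R] F →ₗ[R] F}

theorem IsVectorCrossProduct.rank_mem [Nontrivial R] [Invertible (2 : R)]
    [Module.Finite R F] [Module.Projective R F] (h : IsVectorCrossProduct B cr) {s : ℕ}
    (hs : HasConstantRank R F s) : s = 0 ∨ s = 1 ∨ s = 3 ∨ s = 7 :=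
  let ⟨m, _⟩ := Ideal.exists_maximal R
  (h.rank_eq_and_exists_volume_notMem hs m).1

theorem IsVectorCrossProduct.nonempty_det_linearEquiv [Invertible (2 : R)]
    [Module.Finite R F] [Module.Projective R F] (h : IsVectorCrossProduct B cr) {s : ℕ}
    (hs : HasConstantRank R F s) (h1 : s ≠ 1) : Nonempty ((⋀[R]^s F) ≃ₗ[R] R) :=
  nonempty_linearEquiv_of_surjective (h.volume s)
    (surjective_of_forall_isMaximal _ fun m _ =>
      (h.rank_eq_and_exists_volume_notMem hs m).2 h1)
    (apply_smul_comm_exteriorPower hs h.isSymm h.nondegenerate _)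

end VectorCrossProduct

/-! ### The composition algebra of a cross product -/

section CrossAlgebra

variable {R : Type*} {F : Type*} [CommRing R] [AddCommGroup F] [Module R F]
  {B : LinearMap.BilinForm R F} {cr : F →ₗ[R] F →ₗ[R] F}

/-- The norm `(α, u) ↦ α² + B(u, u)` on the algebra `(R, F, B, ×)`. -/
def CrossAlgebra.norm (B : LinearMap.BilinForm R F) (cr : F →ₗ[R] F →ₗ[R] F) :
    QuadraticForm R (CrossAlgebra B cr) :=
  (QuadraticMap.sq.prod B.toQuadraticMap).comp (CrossAlgebra.linearEquivProd B cr).toLinearMap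

theorem CrossAlgebra.norm_apply (x : CrossAlgebra B cr) :
    CrossAlgebra.norm B cr x = x.fst * x.fst + B x.snd x.snd := rfl

theorem CrossAlgebra.polar_norm (hB : B.IsSymm) (x y : CrossAlgebra B cr) :
    QuadraticMap.polarBilin (CrossAlgebra.norm B cr) x y =
      2 * (x.fst * y.fst + B x.snd y.snd) := by
  have h1 : B y.snd x.snd = B x.snd y.snd := hB.eq _ _
  simp only [QuadraticMap.polarBilin_apply_apply, QuadraticMap.polar, norm_apply, add_fst,
    add_snd, map_add, LinearMap.add_apply, h1]
  ring

theorem IsVectorCrossProduct.isCompositionNorm [Invertible (2 : R)]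
    (h : IsVectorCrossProduct B cr) : IsCompositionNorm (CrossAlgebra.norm B cr) where
  nondegenerate := by
    constructor
    · intro x y hxy
      have hxy' : ∀ z : CrossAlgebra B cr,
          x.fst * z.fst + B x.snd z.snd = y.fst * z.fst + B y.snd z.snd := fun z => by
        have := LinearMap.congr_fun hxy z
        simp only [CrossAlgebra.polar_norm h.isSymm] at this
        exact (isUnit_of_invertible (2 : R)).mul_left_cancel this
      apply CrossAlgebra.ext
      · simpa using hxy' ⟨1, 0⟩
      · exact h.nondegenerate.1 (LinearMap.ext fun v => by simpa using hxy' ⟨0, v⟩)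
    · intro f
      obtain ⟨v, hv⟩ := h.nondegenerate.2
        (f ∘ₗ (CrossAlgebra.linearEquivProd B cr).symm.toLinearMap ∘ₗ LinearMap.inr R R F)
      refine ⟨(⅟2 : R) • ⟨f 1, v⟩, LinearMap.ext fun z => ?_⟩
      have hv' : B v z.snd = f ⟨0, z.snd⟩ := LinearMap.congr_fun hv z.snd
      have hz : z = z.fst • (1 : CrossAlgebra B cr) + ⟨0, z.snd⟩ := by
        apply CrossAlgebra.ext
        · simp [CrossAlgebra.add_fst, CrossAlgebra.smul_fst, CrossAlgebra.one_fst]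
        · simp [CrossAlgebra.add_snd, CrossAlgebra.smul_snd, CrossAlgebra.one_snd]
      have hfz : f z = z.fst * f 1 + f ⟨0, z.snd⟩ := by
        conv_lhs => rw [hz]
        rw [map_add, map_smul, smul_eq_mul]
      simp only [map_smul, LinearMap.smul_apply, smul_eq_mul, CrossAlgebra.polar_norm h.isSymm]
      rw [hv', invOf_mul_cancel_left, hfz, mul_comm]
  map_mul x y := by
    have e1 : B x.snd (cr y.snd x.snd) = 0 := h.apply_cross_right _ _
    have e2 : B y.snd (cr y.snd x.snd) = 0 := h.apply_cross_left _ _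
    simp only [CrossAlgebra.norm_apply, CrossAlgebra.mul_fst, CrossAlgebra.mul_snd, map_add,
      map_smul, LinearMap.add_apply, LinearMap.smul_apply, smul_eq_mul, h.apply_cross_cross,
      h.comm (cr _ _) x.snd, h.comm (cr _ _) y.snd, e1, e2, h.comm y.snd x.snd]
    ring

theorem IsVectorCrossProduct.isCompositionAlgebra [Invertible (2 : R)]
    [Module.Finite R F] [Module.Projective R F] (h : IsVectorCrossProduct B cr) :
    IsCompositionAlgebra R (CrossAlgebra B cr) where
  finite := Module.Finite.equiv (CrossAlgebra.linearEquivProd B cr).symm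
  projective := Module.Projective.of_equiv (CrossAlgebra.linearEquivProd B cr).symm
  faithful := ⟨fun {a b} hab => by
    simpa [CrossAlgebra.smul_fst, CrossAlgebra.one_fst] using
      congrArg CrossAlgebra.fst (hab (1 : CrossAlgebra B cr))⟩
  exists_norm := ⟨_, h.isCompositionNorm⟩

end CrossAlgebra

/-! ### The cross product on the skew elements of a composition algebra -/

section CompositionAlgebra

variable {R : Type*} {C : Type*} [CommRing R] [NonAssocRing C] [Module R C]
  {n : QuadraticForm R C}

theorem polarBilin_comm (n : QuadraticForm R C) (x y : C) :
    n.polarBilin x y = n.polarBilin y x := QuadraticMap.polar_comm _ _ _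

theorem polarBilin_self (n : QuadraticForm R C) (x : C) : n.polarBilin x x = 2 * n x := by
  simp [QuadraticMap.polar_self]

theorem map_add_eq_polarBilin (n : QuadraticForm R C) (x y : C) :
    n (x + y) = n x + n y + n.polarBilin x y := by
  simp [QuadraticMap.polar]

theorem conj_apply (n : QuadraticForm R C) (x : C) :
    conj n x = n.polarBilin 1 x • (1 : C) - x := rfl

theorem conj_of_mem_skew {u : C} (hu : u ∈ skew n) : conj n u = -u := hu

/-- The form `½ n(u, v)` on the skew elements. -/
noncomputable def skewForm [Invertible (2 : R)] (n : QuadraticForm R C) :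
    LinearMap.BilinForm R (skew n) :=
  ⅟(2 : R) • n.polarBilin.compl₁₂ (skew n).subtype (skew n).subtype

theorem skewForm_apply [Invertible (2 : R)] (u v : skew n) :
    skewForm n u v = ⅟(2 : R) * n.polarBilin (u : C) (v : C) := rfl

theorem skewForm_self [Invertible (2 : R)] (u : skew n) : skewForm n u u = n (u : C) := by
  rw [skewForm_apply, polarBilin_self, invOf_mul_cancel_left]

namespace IsCompositionNorm

theorem ext_polarBilin (hn : IsCompositionNorm n) {x y : C}
    (h : ∀ z, n.polarBilin x z = n.polarBilin y z) : x = y :=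
  hn.nondegenerate.1 (LinearMap.ext h)

theorem polarBilin_mul_left (hn : IsCompositionNorm n) (x y z : C) :
    n.polarBilin (x * y) (x * z) = n x * n.polarBilin y z := by
  simp only [QuadraticMap.polarBilin_apply_apply, QuadraticMap.polar, ← mul_add, hn.map_mul]
  ring

theorem polarBilin_mul_add (hn : IsCompositionNorm n) (x w y z : C) :
    n.polarBilin (x * y) (w * z) + n.polarBilin (w * y) (x * z) =
      n.polarBilin x w * n.polarBilin y z := by
  have h1 := hn.polarBilin_mul_left (x + w) y z
  simp only [add_mul, map_add, LinearMap.add_apply, hn.polarBilin_mul_left,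
    map_add_eq_polarBilin] at h1
  linear_combination h1

/-- Left multiplication by `x̄` is adjoint to left multiplication by `x`. -/
theorem polarBilin_mul_eq [IsScalarTower R C C] (hn : IsCompositionNorm n) (x y z : C) :
    n.polarBilin (x * y) z = n.polarBilin y (conj n x * z) := by
  have h1 := hn.polarBilin_mul_add x 1 y z
  rw [one_mul, one_mul, polarBilin_comm n x 1] at h1
  rw [conj_apply, sub_mul, smul_one_mul, map_sub, map_smul, smul_eq_mul]
  linear_combination h1

theorem polarBilin_one_mul [IsScalarTower R C C] (hn : IsCompositionNorm n) {u : C}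
    (hu : u ∈ skew n) (v : C) : n.polarBilin 1 (u * v) = -n.polarBilin u v := by
  rw [polarBilin_comm, hn.polarBilin_mul_eq, conj_of_mem_skew hu, mul_one, map_neg,
    polarBilin_comm]

variable [FaithfulSMul R C]

/-- From `n(1) n(x, z) = n(x, z)`, nondegeneracy gives `n(1) x = x` for all `x`; faithfulness is what
removes `x`. -/
theorem map_one (hn : IsCompositionNorm n) : n 1 = 1 := by
  refine FaithfulSMul.eq_of_smul_eq_smul (α := C) fun x => hn.ext_polarBilin fun z => ?_
  have h1 := hn.polarBilin_mul_left 1 x z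
  rw [one_mul, one_mul] at h1
  rw [one_smul, map_smul, LinearMap.smul_apply, smul_eq_mul, ← h1]

theorem polarBilin_one_one (hn : IsCompositionNorm n) : n.polarBilin 1 1 = 2 := by
  rw [polarBilin_self, hn.map_one, mul_one]

theorem map_conj (hn : IsCompositionNorm n) (x : C) : n (conj n x) = n x := by
  rw [conj_apply, sub_eq_add_neg, map_add_eq_polarBilin, QuadraticMap.map_smul,
    QuadraticMap.map_neg, hn.map_one, map_neg, map_smul, LinearMap.smul_apply]
  simp only [smul_eq_mul]
  ring

variable [IsScalarTower R C C]

theorem mul_conj (hn : IsCompositionNorm n) (x : C) : x * conj n x = n x • (1 : C) := by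
  refine hn.ext_polarBilin fun z => ?_
  rw [hn.polarBilin_mul_eq, map_smul, LinearMap.smul_apply, smul_eq_mul]
  have h1 := hn.polarBilin_mul_left (conj n x) 1 z
  rwa [mul_one, hn.map_conj] at h1

theorem smul_one_injective : Function.Injective (fun r : R => r • (1 : C)) := fun r t h =>
  FaithfulSMul.eq_of_smul_eq_smul (α := C) fun x => by
    rw [← smul_one_mul r x, ← smul_one_mul t x]
    exact congrArg (· * x) h

theorem mem_skew_iff {x : C} : x ∈ skew n ↔ n.polarBilin 1 x = 0 := by
  change conj n x = -x ↔ _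
  rw [conj_apply, sub_eq_neg_self]
  refine ⟨fun h => smul_one_injective (C := C) ?_, fun h => by rw [h, zero_smul]⟩
  simpa using h

theorem mul_self_of_mem_skew (hn : IsCompositionNorm n) {u : C} (hu : u ∈ skew n) :
    u * u = -(n u • (1 : C)) := by
  rw [← hn.mul_conj, conj_of_mem_skew hu, mul_neg, neg_neg]

theorem mul_add_mul_of_mem_skew (hn : IsCompositionNorm n) {u v : C} (hu : u ∈ skew n)
    (hv : v ∈ skew n) : u * v + v * u = -(n.polarBilin u v • (1 : C)) := by
  have h1 := hn.mul_self_of_mem_skew (add_mem hu hv)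
  rw [map_add_eq_polarBilin, mul_add, add_mul, add_mul, hn.mul_self_of_mem_skew hu,
    hn.mul_self_of_mem_skew hv, add_smul, add_smul] at h1
  rw [← sub_eq_zero] at h1 ⊢
  rw [← h1]
  abel

variable [Invertible (2 : R)]

/-- The projection `x ↦ x - ½ n(1, x) 1` onto the skew elements, along `R 1`. -/
noncomputable def skewProj (hn : IsCompositionNorm n) : C →ₗ[R] skew n :=
  (LinearMap.id - (⅟(2 : R) • n.polarBilin 1).smulRight (1 : C)).codRestrict (skew n) fun x =>
    mem_skew_iff.2 <| by
      simp only [LinearMap.sub_apply, LinearMap.id_apply, LinearMap.smulRight_apply,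
        LinearMap.smul_apply, map_sub, map_smul, hn.polarBilin_one_one, smul_eq_mul]
      linear_combination (-n.polarBilin 1 x) * invOf_mul_self (2 : R)

theorem coe_skewProj (hn : IsCompositionNorm n) (x : C) :
    (hn.skewProj x : C) = x - (⅟(2 : R) * n.polarBilin 1 x) • (1 : C) := rfl

theorem skewProj_coe (hn : IsCompositionNorm n) (u : skew n) : hn.skewProj u = u :=
  Subtype.ext <| by rw [coe_skewProj, mem_skew_iff.1 u.2, mul_zero, zero_smul, sub_zero]

theorem skewProj_one (hn : IsCompositionNorm n) : hn.skewProj 1 = 0 :=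
  Subtype.ext <| by
    rw [coe_skewProj, hn.polarBilin_one_one, invOf_mul_self, one_smul, sub_self]; rfl

/-- The decomposition `x ↦ (½ n(1, x), x - ½ n(1, x) 1)` of a composition algebra as `R ⊕ F`. -/
noncomputable def equivProdSkew (hn : IsCompositionNorm n) : C ≃ₗ[R] R × skew n :=
  LinearEquiv.ofLinearMap
    ((⅟(2 : R) • n.polarBilin 1).prod hn.skewProj)
    ((LinearMap.toSpanSingleton R C 1).coprod (skew n).subtype)
    (LinearMap.ext fun p => by
      have h1 := mem_skew_iff.1 p.2.2
      rw [QuadraticMap.polarBilin_apply_apply] at h1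
      have h2 := hn.polarBilin_one_one
      rw [QuadraticMap.polarBilin_apply_apply] at h2
      ext <;> simp [skewProj_one, skewProj_coe, h1, h2, mul_comm p.1])
    (LinearMap.ext fun x => by simp [coe_skewProj])

theorem isCompl_span_one_skew (hn : IsCompositionNorm n) :
    IsCompl (Submodule.span R {(1 : C)}) (skew n) := by
  refine ⟨Submodule.disjoint_def.2 fun x hx hx' => ?_, codisjoint_iff.2 (eq_top_iff.2 ?_)⟩
  · obtain ⟨r, rfl⟩ := Submodule.mem_span_singleton.1 hx
    have h1 := congrArg Subtype.val (hn.skewProj_coe ⟨_, hx'⟩)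
    rw [map_smul, hn.skewProj_one, smul_zero] at h1
    exact h1.symm
  · intro x _
    have hx : x = (⅟(2 : R) * n.polarBilin 1 x) • (1 : C) + hn.skewProj x := by
      rw [coe_skewProj, add_sub_cancel]
    rw [hx]
    exact Submodule.add_mem_sup (Submodule.smul_mem _ _ (Submodule.mem_span_singleton_self _))
      (hn.skewProj x).2

theorem finite_skew [Module.Finite R C] (hn : IsCompositionNorm n) : Module.Finite R (skew n) :=
  Module.Finite.of_surjective hn.skewProj fun u => ⟨u, hn.skewProj_coe u⟩

theorem projective_skew [Module.Projective R C] (hn : IsCompositionNorm n) :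
    Module.Projective R (skew n) :=
  Module.Projective.of_split (skew n).subtype hn.skewProj (LinearMap.ext hn.skewProj_coe)

theorem hasConstantRank_skew [Nontrivial R] [Module.Finite R C] [Module.Projective R C]
    (hn : IsCompositionNorm n) {s : ℕ} (hs : HasConstantRank R C (s + 1)) :
    HasConstantRank R (skew n) s := by
  intro p
  have := hn.finite_skew
  have := hn.projective_skew
  have h1 := hs p
  rw [Module.rankAtStalk_eq_of_equiv hn.equivProdSkew, Module.rankAtStalk_prod,
    Module.rankAtStalk_self, Pi.add_apply, Pi.one_apply] at h1
  omega

variable [SMulCommClass R C C]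

/-- The cross product `½ (u v - v u)` on the skew elements. -/
noncomputable def cross (hn : IsCompositionNorm n) : skew n →ₗ[R] skew n →ₗ[R] skew n :=
  LinearMap.mk₂ R
    (fun u v => ⟨⅟(2 : R) • ((u : C) * (v : C) - (v : C) * (u : C)), mem_skew_iff.2 <| by
      rw [map_smul, map_sub, hn.polarBilin_one_mul u.2, hn.polarBilin_one_mul v.2,
        polarBilin_comm n v u, sub_self, smul_zero]⟩)
    (fun u v w => Subtype.ext <| by
      simp only [Submodule.coe_add, add_mul, mul_add, ← smul_add]
      congr 1
      abel)
    (fun r u v => Subtype.ext <| by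
      simp only [Submodule.coe_smul, smul_mul_assoc, mul_smul_comm, ← smul_sub, smul_comm r])
    (fun u v w => Subtype.ext <| by
      simp only [Submodule.coe_add, add_mul, mul_add, ← smul_add]
      congr 1
      abel)
    (fun r u v => Subtype.ext <| by
      simp only [Submodule.coe_smul, smul_mul_assoc, mul_smul_comm, ← smul_sub, smul_comm r])

theorem coe_cross (hn : IsCompositionNorm n) (u v : skew n) :
    (hn.cross u v : C) = ⅟(2 : R) • ((u : C) * (v : C) - (v : C) * (u : C)) := rfl

/-- The cross product is the product corrected by a scalar: `u × v = u v + B(u, v) 1`. -/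
theorem coe_cross_eq (hn : IsCompositionNorm n) (u v : skew n) :
    (hn.cross u v : C) = u * v + skewForm n u v • (1 : C) := by
  have h1 := hn.mul_add_mul_of_mem_skew u.2 v.2
  rw [coe_cross, skewForm_apply, mul_smul, ← neg_eq_iff_eq_neg.2 h1, smul_neg, ← sub_eq_add_neg,
    eq_sub_iff_add_eq, ← smul_add]
  have h2 : (u * v - v * u + (u * v + v * u) : C) = (2 : R) • (u * v : C) := by
    rw [two_smul]; abel
  rw [h2, invOf_smul_smul]

theorem isVectorCrossProduct (hn : IsCompositionNorm n) :
    IsVectorCrossProduct (skewForm n) hn.cross where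
  isSymm := ⟨fun u v => by
    rw [skewForm_apply, skewForm_apply, polarBilin_comm]⟩
  nondegenerate := by
    constructor
    · intro u v huv
      refine Subtype.ext (hn.ext_polarBilin fun z => ?_)
      have h1 : n.polarBilin u (hn.skewProj z) = n.polarBilin v (hn.skewProj z) :=
        (isUnit_of_invertible (⅟(2 : R))).mul_left_cancel
          (LinearMap.congr_fun huv (hn.skewProj z))
      have hone : ∀ w : skew n, n.polarBilin w 1 = 0 := fun w => by
        rw [polarBilin_comm, mem_skew_iff.1 w.2]
      simpa only [coe_skewProj, map_sub, map_smul, hone, smul_zero, sub_zero] using h1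
    · intro f
      obtain ⟨c, hc⟩ := hn.nondegenerate.2 (f ∘ₗ hn.skewProj)
      have hc' : ∀ x, n.polarBilin c x = f (hn.skewProj x) := LinearMap.congr_fun hc
      have hcs : c ∈ skew n := mem_skew_iff.2 <| by
        rw [polarBilin_comm, hc', hn.skewProj_one, map_zero]
      -- the factor `2` cancels the `½` in `skewForm`
      refine ⟨(2 : R) • ⟨c, hcs⟩, LinearMap.ext fun v => ?_⟩
      change skewForm n _ v = _
      rw [map_smul, LinearMap.smul_apply, skewForm_apply, smul_eq_mul, mul_invOf_cancel_left, hc',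
        skewProj_coe]
  isCrossProduct u := Subtype.ext <| by rw [coe_cross, sub_self, smul_zero]; rfl
  apply_cross_cross u v := by
    rw [skewForm_self, skewForm_self, skewForm_self, hn.coe_cross_eq, map_add_eq_polarBilin,
      hn.map_mul, QuadraticMap.map_smul, hn.map_one, map_smul, polarBilin_comm,
      hn.polarBilin_one_mul u.2, skewForm_apply, smul_eq_mul, smul_eq_mul]
    have h2 := mul_invOf_self (2 : R)
    linear_combination (⅟(2 : R) * n.polarBilin (u : C) v ^ 2) * h2
  apply_cross_left u v := by
    have h1 := hn.polarBilin_mul_left u 1 v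
    rw [mul_one, mem_skew_iff.1 v.2, mul_zero] at h1
    rw [skewForm_apply, hn.coe_cross_eq, map_add, h1, map_smul, polarBilin_comm,
      mem_skew_iff.1 u.2, smul_zero, add_zero, mul_zero]

end IsCompositionNorm

end CompositionAlgebra

end CrossProductAlgebra

open CrossProductAlgebra in
theorem theorem1 {R : Type u} [CommRing R] [Nontrivial R] [Invertible (2 : R)] :
    (∀ (F : Type v) [AddCommGroup F] [Module R F] [Module.Finite R F] [Module.Projective R F]
        (s : ℕ) (_ : HasConstantRank R F s)
        (B : LinearMap.BilinForm R F) (_ : B.IsSymm) (_ : IsNondegenerate B)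
        (cr : F →ₗ[R] F →ₗ[R] F) (_ : IsCrossProduct cr)
        (_ : ∀ u v : F, B (cr u v) (cr u v) = B u u * B v v - B u v ^ 2)
        (_ : ∀ u v : F, B u (cr u v) = 0),
        IsCompositionAlgebra R (CrossAlgebra B cr) ∧
        (s = 0 ∨ s = 1 ∨ s = 3 ∨ s = 7) ∧
        (s ≠ 1 → Nonempty ((⋀[R]^s F) ≃ₗ[R] R)) ∧
        Nonempty (((⋀[R]^s F) ⊗[R] (⋀[R]^s F)) ≃ₗ[R] R)) ∧
    (∀ (C : Type w) [NonAssocRing C] [Module R C] [IsScalarTower R C C] [SMulCommClass R C C]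
        (_ : IsCompositionAlgebra R C) (n : QuadraticForm R C) (_ : IsCompositionNorm n)
        (s : ℕ) (_ : HasConstantRank R C (s + 1)),
        -- `C = R ⊕ F`, where `R` is identified with `R 1` and `F = skew n`
        Function.Injective (fun r : R => r • (1 : C)) ∧
        IsCompl (Submodule.span R {(1 : C)}) (skew n) ∧
        Module.Finite R (skew n) ∧ Module.Projective R (skew n) ∧
        HasConstantRank R (skew n) s ∧
        (s = 0 ∨ s = 1 ∨ s = 3 ∨ s = 7) ∧
        (s ≠ 1 → Nonempty ((⋀[R]^s (skew n)) ≃ₗ[R] R)) ∧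
        Nonempty (((⋀[R]^s (skew n)) ⊗[R] (⋀[R]^s (skew n))) ≃ₗ[R] R) ∧
        ∃ (cr : skew n →ₗ[R] skew n →ₗ[R] skew n) (B : LinearMap.BilinForm R (skew n)),
          (∀ u v : skew n,
            ((cr u v : skew n) : C) = ⅟(2 : R) • ((u : C) * (v : C) - (v : C) * (u : C))) ∧
          (∀ u v : skew n,
            B u v • (1 : C) = -(⅟(2 : R) • ((u : C) * (v : C) + (v : C) * (u : C)))) ∧
          (∀ u v : skew n,
            B u v • (1 : C) =
              ⅟(2 : R) • ((u : C) * conj n (v : C) + (v : C) * conj n (u : C))) ∧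
          (∀ u v : skew n, B u v = ⅟(2 : R) * QuadraticMap.polar n (u : C) (v : C)) ∧
          IsCrossProduct cr ∧ B.IsSymm ∧ IsNondegenerate B ∧
          (∀ u v : skew n, B (cr u v) (cr u v) = B u u * B v v - B u v ^ 2) ∧
          (∀ u v : skew n, B u (cr u v) = 0)) := by
  refine ⟨?_, ?_⟩
  · intro F _ _ _ _ s hs B hB hnd cr hcr h1 h2
    have h : IsVectorCrossProduct B cr := ⟨hB, hnd, hcr, h1, h2⟩
    exact ⟨h.isCompositionAlgebra, h.rank_mem hs, h.nonempty_det_linearEquiv hs,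
      nonempty_det_tensor_det_linearEquiv hs hB hnd⟩
  · intro C _ _ _ _ hC n hn s hs
    have := hC.finite
    have := hC.projective
    have := hC.faithful
    have := hn.finite_skew
    have := hn.projective_skew
    have hF := hn.hasConstantRank_skew hs
    have h := hn.isVectorCrossProduct
    have hanti : ∀ u v : skew n,
        skewForm n u v • (1 : C) = -(⅟(2 : R) • ((u : C) * (v : C) + (v : C) * (u : C))) := by
      intro u v
      rw [hn.mul_add_mul_of_mem_skew u.2 v.2, smul_neg, neg_neg, smul_smul]
      rfl
    refine ⟨IsCompositionNorm.smul_one_injective, hn.isCompl_span_one_skew, inferInstance,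
      inferInstance, hF, h.rank_mem hF, h.nonempty_det_linearEquiv hF,
      nonempty_det_tensor_det_linearEquiv hF h.isSymm h.nondegenerate,
      hn.cross, skewForm n, hn.coe_cross, hanti, fun u v => ?_, fun u v => rfl,
      h.isCrossProduct, h.isSymm, h.nondegenerate, h.apply_cross_cross, h.apply_cross_left⟩
    rw [hanti, conj_of_mem_skew u.2, conj_of_mem_skew v.2, mul_neg, mul_neg, ← neg_add, smul_neg]
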